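/- Let $R$ be a (commutative) Dedekind domain with quotient field $K$, and let $G$ be a finite group acting on $R$ by ring automorphisms $\sigma_g$, extended to $K$; write $R^G$ for the ring of invariants. Let $A = K\diamondsuit_{\sigma,\alpha} G$ be a crystalline graded ring: a ring containing $K$ as a subring with the same identity, with elements $u_g$ ($g\in G$), $u_e = 1$, such that $A=\bigoplus_{g\in G} K u_g$ with each $u_g$ a left $K$-basis of $Ku_g$, and such that $u_g k = \sigma_g(k)u_g$ and $u_g u_h=\alpha(g,h)u_{gh}$ for all $k\in K$ and $g,h\in G$, where $\alpha(g,h)\in K\setminus\{0\}$. ($K$ need not be central in $A$.) An $R$-lattice in $A$ is an $R$-torsionfree $R$-sub-bimodule $M\subset A$, on which the left and right actions of $R^G$ coincide, that is finitely generated as a left and as a right $R$-module; it is full if $KM=A=MK$. A subset $T\subset A$ is graded if $\sum_{g} x_g u_g\in T$ (with $x_g\in K$) implies $x_g u_g\in T$ for all $g \in G$. A gr-order in $A$ is a subring of $A$ with the same identity element that is a graded full $R$-lattice in $A$; a gr-maximal order is a gr-order that is maximal, with respect to inclusion, among the gr-orders in $A$. For a full $R$-lattice $M$ in $A$ put $O_l(M)=\{x\in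 A : xM\subset M\}$ and $O_r(M)=\{x\in A : Mx\subset M\}$. Theorem. Let $M$ be a full graded $R$-lattice in $A$. Then $O_l(M)$ is a gr-maximal order if and only if $O_r(M)$ is a gr-maximal order. -/

import Mathlib

/-- The extension `σ_g : K ≃+* K` to the quotient field `K` of `R` of the automorphism
`r ↦ g • r` of `R`. -/
noncomputable def fracAut (R K : Type*) {G : Type*} [CommRing R] [Field K] [Algebra R K]
    [IsFractionRing R K] [Group G] [MulSemiringAction G R] (g : G) : K ≃+* K :=
  IsFractionRing.ringEquivOfRingEquiv (MulSemiringAction.toRingEquiv G R g)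

/-- A presentation of the ring `A` as a crystalline graded ring `K ◇_{σ,α} G`, where `G` is a
finite group acting on `R` by ring automorphisms and `σ` is the induced action on the quotient
field `K` of `R`. Neither `K` nor `R` need be central in `A`. -/
structure CrystallineGraded (R K G A : Type*) [CommRing R] [Field K] [Algebra R K]
    [IsFractionRing R K] [Group G] [Fintype G] [MulSemiringAction G R] [Ring A] where
  /-- the inclusion `K ⊂ A` (with `1_K = 1_A`) -/
  incl : K →+* A
  /-- the homogeneous basis elements `u_g` -/
  u : G → A
  /-- the structure constants `α(g,h)` -/
  α : G → G → K
  u_one : u 1 = 1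
  /-- `A = ⊕_g K u_g`, and every `K u_g` is a free left `K`-module with basis `u_g` -/
  existsUnique_coeff : ∀ a : A, ∃! c : G → K, a = ∑ g, incl (c g) * u g
  /-- `u_g k = σ_g(k) u_g`, so that `K u_g = u_g K` -/
  u_mul_incl : ∀ (g : G) (k : K), u g * incl k = incl (fracAut R K g k) * u g
  /-- `u_g u_h = α(g,h) u_{gh}`, so that `A` is `G`-graded with `A_g = K u_g` -/
  u_mul_u : ∀ g h : G, u g * u h = incl (α g h) * u (g * h)
  /-- torsion-freeness: no `α(g,h)` is a zero divisor of the field `K` -/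
  α_ne_zero : ∀ g h : G, α g h ≠ 0

namespace CrystallineGraded

variable {R K G A : Type*} [CommRing R] [Field K] [Algebra R K] [IsFractionRing R K]
  [Group G] [Fintype G] [MulSemiringAction G R] [Ring A]

/-- The inclusion `R ⊂ K ⊂ A`. -/
def inclR (C : CrystallineGraded R K G A) : R →+* A :=
  C.incl.comp (algebraMap R K)

/-- For a ring `B` mapped to `A` by `f` and `S ⊂ A`: the additive subgroup `BS` of all finite
sums of elements `b s`. -/
def leftSpan {B : Type*} [Semiring B] (f : B →+* A) (S : Set A) : AddSubgroup A :=
  AddSubgroup.closure {x | ∃ b : B, ∃ s ∈ S, x = f b * s}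

/-- For a ring `B` mapped to `A` by `f` and `S ⊂ A`: the additive subgroup `SB` of all finite
sums of elements `s b`. -/
def rightSpan {B : Type*} [Semiring B] (f : B →+* A) (S : Set A) : AddSubgroup A :=
  AddSubgroup.closure {x | ∃ b : B, ∃ s ∈ S, x = s * f b}

/-- `M` is an `R`-lattice in `A`: an `R`-torsionfree `R`-bimodule over `R^G` inside `A` that is
finitely generated both as a left and as a right `R`-module. -/
structure IsLattice (C : CrystallineGraded R K G A) (M : AddSubgroup A) : Prop where
  mul_left_mem : ∀ (r : R), ∀ m ∈ M, C.inclR r * m ∈ M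
  mul_right_mem : ∀ (r : R), ∀ m ∈ M, m * C.inclR r ∈ M
  /-- the left and right actions of the invariant ring `R^G` on `M` agree -/
  invariant_comm : ∀ a : R, (∀ g : G, g • a = a) → ∀ m ∈ M, C.inclR a * m = m * C.inclR a
  torsionfree_left : ∀ (r : R), ∀ m ∈ M, C.inclR r * m = 0 → r = 0 ∨ m = 0
  torsionfree_right : ∀ (r : R), ∀ m ∈ M, m * C.inclR r = 0 → r = 0 ∨ m = 0
  fg_left : ∃ S : Finset A, leftSpan C.inclR (S : Set A) = M
  fg_right : ∃ S : Finset A, rightSpan C.inclR (S : Set A) = M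

/-- `M` is a full `R`-lattice in `A`: an `R`-lattice with `KM = A = MK`. -/
structure IsFullLattice (C : CrystallineGraded R K G A) (M : AddSubgroup A) : Prop
    extends C.IsLattice M where
  left_full : leftSpan C.incl (M : Set A) = ⊤
  right_full : rightSpan C.incl (M : Set A) = ⊤

/-- `T ⊂ A` is graded: with `x = ∑ x_g u_g` it contains every component `x_g u_g`. -/
def IsGraded (C : CrystallineGraded R K G A) (T : Set A) : Prop :=
  ∀ c : G → K, ∑ g, C.incl (c g) * C.u g ∈ T → ∀ g, C.incl (c g) * C.u g ∈ T

/-- A gr-order in `A`: a subring (with the same identity element) that is a graded full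
`R`-lattice. -/
structure IsGrOrder (C : CrystallineGraded R K G A) (Λ : Subring A) : Prop where
  isFullLattice : C.IsFullLattice Λ.toAddSubgroup
  isGraded : C.IsGraded (Λ : Set A)

/-- A gr-maximal order in `A`: a gr-order that is maximal among the gr-orders in `A`. -/
def IsGrMaximalOrder (C : CrystallineGraded R K G A) (Λ : Subring A) : Prop :=
  Maximal C.IsGrOrder Λ

end CrystallineGraded

/-- The left order `O_l(M) = {x ∈ A | xM ⊂ M}`. -/
def leftOrder {A : Type*} [Ring A] (M : AddSubgroup A) : Subring A where
  carrier := {x | ∀ m ∈ M, x * m ∈ M}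
  mul_mem' {x y} hx hy m hm := by rw [mul_assoc]; exact hx _ (hy _ hm)
  one_mem' m hm := by rwa [one_mul]
  add_mem' {x y} hx hy m hm := by rw [add_mul]; exact M.add_mem (hx _ hm) (hy _ hm)
  zero_mem' m _ := by rw [zero_mul]; exact M.zero_mem
  neg_mem' {x} hx m hm := by rw [neg_mul]; exact M.neg_mem (hx _ hm)

/-- The right order `O_r(M) = {x ∈ A | Mx ⊂ M}`. -/
def rightOrder {A : Type*} [Ring A] (M : AddSubgroup A) : Subring A where
  carrier := {x | ∀ m ∈ M, m * x ∈ M}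
  mul_mem' {x y} hx hy m hm := by rw [← mul_assoc]; exact hy _ (hx _ hm)
  one_mem' m hm := by rwa [mul_one]
  add_mem' {x y} hx hy m hm := by rw [mul_add]; exact M.add_mem (hx _ hm) (hy _ hm)
  zero_mem' m _ := by rw [mul_zero]; exact M.zero_mem
  neg_mem' {x} hx m hm := by rw [mul_neg]; exact M.neg_mem (hx _ hm)

/-! The problem is reduced to integer functions on a groupoid. Put `n = |G|` and regard a pair `(g,
Q)`, with `Q` a maximal ideal of `R`, as an arrow `Q → g • Q`. The weight of `x u_g` at `Q` is `n`
times the valuation of `x` at `g • Q`, corrected by a sum of valuations of the `α(g,k)`. Summing the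
cocycle identity over `k` shows that weights add along composable arrows (`weight_mul`), and the
weights on a given arrow form one class modulo `n`. A full graded lattice is determined by its
level, the least weight on each arrow; the level of an order is subadditive.

A subadditive `f` lies above a potential difference `p (g • Q) - p Q` on each orbit. The elements of
weight at least that difference form a larger gr-order, so for a gr-maximal order `f` is this
difference rounded up to its class modulo `n` (`exists_isPotentialPair`). If `O_l(M)` is gr-maximal
with potential `p`, the level of `M` is likewise `p (g • Q) - q Q` rounded up, for a second
potential `q` (`IsPotentialPair.of_module`).

Rounding shows that elements of weight at least `q (g • Q) - q Q` preserve `M` from the right. Let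
`Γ` be a gr-order containing `O_r(M)`. Its level is at most `q (b • Q) - q Q` on each arrow whose
class contains that difference. There are enough such arrows to close any arrow to a loop, and
subadditive functions are nonnegative on loops, so the level of `Γ` is at least the potential
difference everywhere (`IsPotentialPair.sub_le`). Hence `MΓ ⊂ M` and `Γ = O_r(M)`. The other
implication follows by passing to the opposite ring. -/

open scoped nonZeroDivisors Pointwise
open IsDedekindDomain FractionalIdeal

/-! ### Valuations of a Dedekind domain and membership in fractional ideals -/

section Valuation

variable {R : Type*} [CommRing R] [IsDedekindDomain R] (K : Type*) [Field K] [Algebra R K]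
  [IsFractionRing R K]

/-- The additive valuation of `x : K` at a maximal ideal of `R`; the value at `0` is `0`. -/
noncomputable def ordAt (P : HeightOneSpectrum R) (x : K) : ℤ :=
  count K P (spanSingleton R⁰ x)

variable {K}

theorem ordAt_mul (P : HeightOneSpectrum R) {x y : K} (hx : x ≠ 0) (hy : y ≠ 0) :
    ordAt K P (x * y) = ordAt K P x + ordAt K P y := by
  rw [ordAt, ← spanSingleton_mul_spanSingleton, count_mul]
  · rfl
  · exact spanSingleton_ne_zero_iff.mpr hx
  · exact spanSingleton_ne_zero_iff.mpr hy

theorem ordAt_one (P : HeightOneSpectrum R) : ordAt K P 1 = 0 := by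
  rw [ordAt, spanSingleton_one, count_one]

theorem ordAt_pow (P : HeightOneSpectrum R) (x : K) (n : ℕ) :
    ordAt K P (x ^ n) = n * ordAt K P x := by
  rw [ordAt, ← spanSingleton_pow, count_pow]; rfl

theorem ordAt_prod (P : HeightOneSpectrum R) {ι : Type*} (s : Finset ι) (x : ι → K)
    (hx : ∀ i, x i ≠ 0) : ordAt K P (∏ i ∈ s, x i) = ∑ i ∈ s, ordAt K P (x i) := by
  classical
  induction s using Finset.induction with
  | empty => simp [ordAt_one]
  | insert i s hi ih =>
    rw [Finset.prod_insert hi, Finset.sum_insert hi,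
      ordAt_mul P (hx i) (Finset.prod_ne_zero_iff.mpr fun j _ => hx j), ih]

/-- If all exponents of `J⁻¹ * I` are nonnegative, its prime factorization exhibits it as a product
of integral ideals. -/
theorem FractionalIdeal.le_iff_count_le {I J : FractionalIdeal R⁰ K} (hI : I ≠ 0) (hJ : J ≠ 0) :
    I ≤ J ↔ ∀ P : HeightOneSpectrum R, count K P J ≤ count K P I := by
  refine ⟨fun h P => count_mono K P hI h, fun h => ?_⟩
  have hne : J⁻¹ * I ≠ 0 := mul_ne_zero (inv_ne_zero hJ) hI
  have hle : J⁻¹ * I ≤ 1 := by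
    rw [← finprod_heightOneSpectrum_factorization' K hne]
    refine finprod_induction (fun L : FractionalIdeal R⁰ K => L ≤ 1) le_rfl
      (fun L L' hL hL' => mul_le_one' hL hL') fun P => ?_
    have h0 : 0 ≤ count K P (J⁻¹ * I) := by
      rw [count_mul K P (inv_ne_zero hJ) hI, count_inv]
      linarith [h P]
    obtain ⟨k, hk⟩ := Int.eq_ofNat_of_zero_le h0
    rw [hk, zpow_natCast]
    exact pow_le_one' coeIdeal_le_one k
  calc I = J * (J⁻¹ * I) := by rw [← mul_assoc, mul_inv_cancel₀ hJ, one_mul]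
    _ ≤ J * 1 := by gcongr
    _ = J := mul_one J

theorem FractionalIdeal.mem_iff_count_le_ordAt {I : FractionalIdeal R⁰ K} (hI : I ≠ 0) {x : K}
    (hx : x ≠ 0) : x ∈ I ↔ ∀ P : HeightOneSpectrum R, count K P I ≤ ordAt K P x := by
  rw [← spanSingleton_le_iff_mem, le_iff_count_le (spanSingleton_ne_zero_iff.mpr hx) hI]
  rfl

/-- Some element of a fractional ideal has the least possible valuation at `P`. -/
theorem FractionalIdeal.exists_ordAt_eq_count {I : FractionalIdeal R⁰ K} (hI : I ≠ 0)
    (P : HeightOneSpectrum R) : ∃ x ∈ I, x ≠ 0 ∧ ordAt K P x = count K P I := by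
  have hP : (P.asIdeal : FractionalIdeal R⁰ K) ≠ 0 := coeIdeal_ne_zero.mpr P.ne_bot
  by_contra! h
  -- If no element attained the minimum at `P`, all of `I` would lie in `I * P`, whose exponent at
  -- `P` is larger by one.
  have hle : I ≤ I * (P.asIdeal : FractionalIdeal R⁰ K) := by
    intro x hx
    rcases eq_or_ne x 0 with rfl | h0
    · exact Submodule.zero_mem _
    rw [mem_iff_count_le_ordAt (mul_ne_zero hI hP) h0]
    intro Q
    have hQ := (mem_iff_count_le_ordAt hI h0).1 hx Q
    rw [count_mul K Q hI hP]
    by_cases hPQ : P = Q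
    · subst hPQ
      have := h x hx h0
      rw [count_self]
      lia
    · rw [count_maximal_coprime K Q hPQ]
      lia
  have := count_mono K P hI hle
  rw [count_mul K P hI hP, count_self] at this
  lia

theorem ordAt_algebraMap_nonneg (P : HeightOneSpectrum R) (r : R) :
    0 ≤ ordAt K P (algebraMap R K r) := by
  rw [ordAt, ← coeIdeal_span_singleton]
  exact count_coe_nonneg K P _

theorem le_ordAt_algebraMap_iff (P : HeightOneSpectrum R) {r : R} (hr : r ≠ 0) (n : ℕ) :
    (n : ℤ) ≤ ordAt K P (algebraMap R K r) ↔ r ∈ P.asIdeal ^ n := by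
  have hP : (P.asIdeal : FractionalIdeal R⁰ K) ≠ 0 := coeIdeal_ne_zero.mpr P.ne_bot
  have hr' : algebraMap R K r ≠ 0 := by simpa using hr
  have hmem : r ∈ P.asIdeal ^ n ↔
      algebraMap R K r ∈ ((P.asIdeal ^ n : Ideal R) : FractionalIdeal R⁰ K) := by
    rw [mem_coeIdeal]
    exact ⟨fun h => ⟨r, h, rfl⟩, fun ⟨s, hs, h⟩ => IsFractionRing.injective R K h ▸ hs⟩
  rw [hmem, coeIdeal_pow,
    mem_iff_count_le_ordAt (pow_ne_zero n hP) hr']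
  refine ⟨fun h Q => ?_, fun h => by simpa [count_pow, count_self] using h P⟩
  rw [count_pow]
  by_cases hPQ : P = Q
  · subst hPQ
    rwa [count_self, mul_one]
  · rw [count_maximal_coprime K Q hPQ, mul_zero]
    exact ordAt_algebraMap_nonneg Q r

/-- There is an element with a simple pole at `P` and no other poles. -/
theorem exists_ordAt_eq_neg_one (P : HeightOneSpectrum R) :
    ∃ t : K, t ≠ 0 ∧ ordAt K P t = -1 ∧ ∀ Q, Q ≠ P → 0 ≤ ordAt K Q t := by
  have hP : (P.asIdeal : FractionalIdeal R⁰ K) ≠ 0 := coeIdeal_ne_zero.mpr P.ne_bot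
  obtain ⟨t, ht, h0, h1⟩ := exists_ordAt_eq_count (inv_ne_zero hP) P
  refine ⟨t, h0, by rw [h1, count_inv, count_self], fun Q hQ => ?_⟩
  have := (mem_iff_count_le_ordAt (inv_ne_zero hP) h0).1 ht Q
  rwa [count_inv, count_maximal_coprime K Q hQ.symm, neg_zero] at this

/-- The ultrametric inequality. A common denominator reduces it to elements of `R`, where it says
that `P ^ k` is closed under addition. -/
theorem le_ordAt_add {P : HeightOneSpectrum R} {x y : K} (hxy : x + y ≠ 0) {c : ℤ}
    (hx : x ≠ 0 → c ≤ ordAt K P x) (hy : y ≠ 0 → c ≤ ordAt K P y) : c ≤ ordAt K P (x + y) := by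
  rcases eq_or_ne x 0 with rfl | hx0
  · rw [zero_add] at hxy ⊢; exact hy hxy
  rcases eq_or_ne y 0 with rfl | hy0
  · rw [add_zero] at hxy ⊢; exact hx hxy
  obtain ⟨a, b, d, hd, rfl, rfl⟩ : ∃ a b d : R, d ≠ 0 ∧
      x = algebraMap R K a / algebraMap R K d ∧ y = algebraMap R K b / algebraMap R K d := by
    obtain ⟨a, s, hs, rfl⟩ := IsFractionRing.div_surjective R x
    obtain ⟨b, t, ht, rfl⟩ := IsFractionRing.div_surjective R y
    have hs' : algebraMap R K s ≠ 0 := by simpa using nonZeroDivisors.ne_zero hs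
    have ht' : algebraMap R K t ≠ 0 := by simpa using nonZeroDivisors.ne_zero ht
    refine ⟨a * t, b * s, s * t,
      mul_ne_zero (nonZeroDivisors.ne_zero hs) (nonZeroDivisors.ne_zero ht), ?_, ?_⟩ <;>
    · simp only [map_mul]
      field_simp
  have hd' : algebraMap R K d ≠ 0 := by simpa using hd
  have key (r : R) (hr : algebraMap R K r / algebraMap R K d ≠ 0) :
      r ≠ 0 ∧ ordAt K P (algebraMap R K r) =
        ordAt K P (algebraMap R K r / algebraMap R K d) + ordAt K P (algebraMap R K d) := by
    refine ⟨fun h => hr (by simp [h]), ?_⟩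
    rw [← ordAt_mul P hr hd', div_mul_cancel₀ _ hd']
  rw [← add_div, ← map_add] at hxy ⊢
  obtain ⟨ha, ha'⟩ := key a hx0
  obtain ⟨hb, hb'⟩ := key b hy0
  obtain ⟨hab, hab'⟩ := key (a + b) hxy
  have hx := hx hx0
  have hy := hy hy0
  rcases lt_or_ge (c + ordAt K P (algebraMap R K d)) 0 with hneg | hpos
  · have := ordAt_algebraMap_nonneg (K := K) P (a + b)
    lia
  · obtain ⟨k, hk⟩ := Int.eq_ofNat_of_zero_le hpos
    have := (le_ordAt_algebraMap_iff (K := K) P hab k).2 (Ideal.add_mem _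
      ((le_ordAt_algebraMap_iff (K := K) P ha k).1 (by lia))
      ((le_ordAt_algebraMap_iff (K := K) P hb k).1 (by lia)))
    lia

end Valuation

/-! ### The action of `G` on maximal ideals and on valuations -/

section Action

variable {R G : Type*} [CommRing R] [Group G] [MulSemiringAction G R]

/-- The action of `G` on the maximal ideals of `R`. -/
instance heightOneSpectrumMulAction : MulAction G (HeightOneSpectrum R) where
  smul g P := ⟨g • P.asIdeal, P.isPrime.smul g, fun h => P.ne_bot <| by
    rw [← inv_smul_smul g P.asIdeal, h, Ideal.smul_bot]⟩
  one_smul P := HeightOneSpectrum.ext (one_smul G P.asIdeal)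
  mul_smul g h P := HeightOneSpectrum.ext (mul_smul g h P.asIdeal)

theorem asIdeal_smul (g : G) (P : HeightOneSpectrum R) : (g • P).asIdeal = g • P.asIdeal := rfl

variable {K : Type*} [Field K] [Algebra R K] [IsFractionRing R K]

theorem fracAut_algebraMap (g : G) (r : R) :
    fracAut R K g (algebraMap R K r) = algebraMap R K (g • r) := by
  simp [fracAut]

theorem fracAut_one (x : K) : fracAut R K (1 : G) x = x := by
  obtain ⟨a, b, -, rfl⟩ := IsFractionRing.div_surjective R x
  simp [fracAut_algebraMap]

theorem fracAut_mul (g h : G) (x : K) :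
    fracAut R K (g * h) x = fracAut R K g (fracAut R K h x) := by
  obtain ⟨a, b, -, rfl⟩ := IsFractionRing.div_surjective R x
  simp [fracAut_algebraMap, mul_smul]

theorem ordAt_smul_algebraMap [IsDedekindDomain R] (g : G) (P : HeightOneSpectrum R) {r : R}
    (hr : r ≠ 0) : ordAt K (g • P) (algebraMap R K (g • r)) = ordAt K P (algebraMap R K r) := by
  have hgr : g • r ≠ 0 := (smul_ne_zero_iff_ne g).mpr hr
  have key (n : ℕ) : (n : ℤ) ≤ ordAt K (g • P) (algebraMap R K (g • r)) ↔
      (n : ℤ) ≤ ordAt K P (algebraMap R K r) := by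
    rw [le_ordAt_algebraMap_iff _ hgr, le_ordAt_algebraMap_iff _ hr, asIdeal_smul, ← smul_pow',
      Ideal.smul_mem_pointwise_smul_iff]
  obtain ⟨a, ha⟩ := Int.eq_ofNat_of_zero_le
    (ordAt_algebraMap_nonneg (K := K) (g • P) (g • r))
  obtain ⟨b, hb⟩ := Int.eq_ofNat_of_zero_le (ordAt_algebraMap_nonneg (K := K) P r)
  have h1 := key a
  have h2 := key b
  lia

theorem ordAt_smul_fracAut [IsDedekindDomain R] (g : G) (P : HeightOneSpectrum R) {x : K}
    (hx : x ≠ 0) : ordAt K (g • P) (fracAut R K g x) = ordAt K P x := by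
  obtain ⟨a, s, hs, rfl⟩ := IsFractionRing.div_surjective R x
  have hs0 := nonZeroDivisors.ne_zero hs
  have ha0 : a ≠ 0 := fun h => hx (by simp [h])
  have hs' : algebraMap R K s ≠ 0 := by simpa using hs0
  have h1 : ordAt K P (algebraMap R K a) =
      ordAt K P (algebraMap R K a / algebraMap R K s) + ordAt K P (algebraMap R K s) := by
    rw [← ordAt_mul P hx hs', div_mul_cancel₀ _ hs']
  have h2 : ordAt K (g • P) (fracAut R K g (algebraMap R K a)) =
      ordAt K (g • P) (fracAut R K g (algebraMap R K a / algebraMap R K s)) +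
        ordAt K (g • P) (fracAut R K g (algebraMap R K s)) := by
    rw [← ordAt_mul (g • P) (by simpa using hx) (by simpa using hs0), ← map_mul,
      div_mul_cancel₀ _ hs']
  rw [fracAut_algebraMap, fracAut_algebraMap, ordAt_smul_algebraMap g P ha0,
    ordAt_smul_algebraMap g P hs0] at h2
  lia

end Action

/-! ### Homogeneous components and coefficients -/

namespace CrystallineGraded

section Coefficients

variable {R K G A : Type*} [CommRing R] [Field K] [Algebra R K] [IsFractionRing R K]
  [Group G] [Fintype G] [MulSemiringAction G R] [Ring A] (C : CrystallineGraded R K G A)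

/-- The homogeneous element `x u_g`. -/
def hom (g : G) (x : K) : A := C.incl x * C.u g

/-- The coefficients of an element of `A` with respect to the basis `u_g`. -/
noncomputable def coeff (a : A) : G → K := (C.existsUnique_coeff a).choose

theorem sum_coeff (a : A) : ∑ g, C.hom g (C.coeff a g) = a :=
  (C.existsUnique_coeff a).choose_spec.1.symm

theorem coeff_eq {a : A} {c : G → K} (h : a = ∑ g, C.hom g (c g)) : C.coeff a = c :=
  ((C.existsUnique_coeff a).choose_spec.2 c h).symm

theorem hom_add (g : G) (x y : K) : C.hom g (x + y) = C.hom g x + C.hom g y := by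
  simp [hom, add_mul]

@[simp] theorem hom_zero (g : G) : C.hom g 0 = 0 := by simp [hom]

theorem incl_mul_hom (k : K) (g : G) (x : K) : C.incl k * C.hom g x = C.hom g (k * x) := by
  simp [hom, mul_assoc]

theorem hom_mul_incl (g : G) (x k : K) :
    C.hom g x * C.incl k = C.hom g (x * fracAut R K g k) := by
  rw [hom, mul_assoc, C.u_mul_incl, ← mul_assoc, ← map_mul, hom]

theorem hom_mul_hom (g h : G) (x y : K) :
    C.hom g x * C.hom h y = C.hom (g * h) (x * fracAut R K g y * C.α g h) := by
  rw [hom, hom, mul_assoc, ← mul_assoc (C.u g), C.u_mul_incl, mul_assoc, C.u_mul_u]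
  simp only [hom, map_mul, mul_assoc]

theorem hom_one_one : C.hom 1 1 = 1 := by simp [hom, C.u_one]

theorem coeff_hom [DecidableEq G] (g : G) (x : K) : C.coeff (C.hom g x) = Pi.single g x := by
  apply C.coeff_eq
  rw [Finset.sum_eq_single g]
  · simp
  · intro h _ hne; simp [Pi.single_eq_of_ne hne]
  · simp

theorem hom_injective (g : G) : Function.Injective (C.hom g) := by
  classical
  intro x y h
  have := congrFun (congrArg C.coeff h) g
  simpa [coeff_hom] using this

theorem coeff_add (a b : A) : C.coeff (a + b) = C.coeff a + C.coeff b := by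
  apply C.coeff_eq
  simp only [Pi.add_apply, hom_add, Finset.sum_add_distrib, sum_coeff]

theorem coeff_zero : C.coeff 0 = 0 := C.coeff_eq (by simp)

theorem coeff_neg (a : A) : C.coeff (-a) = -C.coeff a := by
  rw [eq_neg_iff_add_eq_zero, ← coeff_add, neg_add_cancel, coeff_zero]

theorem coeff_incl_mul (k : K) (a : A) (g : G) : C.coeff (C.incl k * a) g = k * C.coeff a g := by
  refine congrFun (C.coeff_eq (c := fun g => k * C.coeff a g) ?_) g
  simp only [← incl_mul_hom, ← Finset.mul_sum, sum_coeff]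

theorem coeff_mul_incl (k : K) (a : A) (g : G) :
    C.coeff (a * C.incl k) g = C.coeff a g * fracAut R K g k := by
  refine congrFun (C.coeff_eq (c := fun g => C.coeff a g * fracAut R K g k) ?_) g
  simp only [← hom_mul_incl, ← Finset.sum_mul, sum_coeff]

theorem coeff_hom_mul (h : G) (y : K) (a : A) (g : G) :
    C.coeff (C.hom h y * a) (h * g) = y * fracAut R K h (C.coeff a g) * C.α h g := by
  have : C.coeff (C.hom h y * a) = fun k =>
      y * fracAut R K h (C.coeff a (h⁻¹ * k)) * C.α h (h⁻¹ * k) := by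
    apply C.coeff_eq
    rw [← Equiv.sum_comp (Equiv.mulLeft h)]
    simp only [Equiv.coe_mulLeft, inv_mul_cancel_left, ← hom_mul_hom, ← Finset.mul_sum, sum_coeff]
  simp [this]

theorem ext_coeff {a b : A} (h : C.coeff a = C.coeff b) : a = b := by
  rw [← C.sum_coeff a, ← C.sum_coeff b, h]

theorem α_one_left (k : G) : C.α 1 k = 1 := by
  have h := C.u_mul_u 1 k
  rw [C.u_one, one_mul, one_mul] at h
  refine C.hom_injective k ?_
  simp [hom, ← h]

theorem α_cocycle (g h k : G) :
    C.α g h * C.α (g * h) k = fracAut R K g (C.α h k) * C.α g (h * k) := by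
  have h1 := mul_assoc (C.hom g 1) (C.hom h 1) (C.hom k 1)
  simp only [hom_mul_hom, map_one, one_mul, mul_one, mul_assoc g h k] at h1
  exact C.hom_injective _ h1

theorem hom_mul_coeff_ne_zero (g h : G) {x y : K} (hx : x ≠ 0) (hy : y ≠ 0) :
    x * fracAut R K g y * C.α g h ≠ 0 :=
  mul_ne_zero (mul_ne_zero hx (by simpa using hy)) (C.α_ne_zero g h)

theorem IsGraded.hom_coeff_mem {C : CrystallineGraded R K G A} {D : AddSubgroup A}
    (hD : C.IsGraded (D : Set A)) {a : A} (ha : a ∈ D) (g : G) : C.hom g (C.coeff a g) ∈ D :=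
  hD (C.coeff a) (by rw [← C.sum_coeff a] at ha; exact ha) g

theorem mem_of_hom_coeff_mem {D : AddSubgroup A} {a : A} (h : ∀ g, C.hom g (C.coeff a g) ∈ D) :
    a ∈ D := by
  rw [← C.sum_coeff a]
  exact D.sum_mem fun g _ => h g

theorem isGraded_of_hom_coeff_mem {T : Set A}
    (h : ∀ a ∈ T, ∀ g, C.hom g (C.coeff a g) ∈ T) : C.IsGraded T := by
  intro c hc g
  have hcoeff : C.coeff (∑ g, C.incl (c g) * C.u g) = c := C.coeff_eq rfl
  have := h _ hc g
  rwa [hcoeff] at this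

variable {C} {M : AddSubgroup A}

theorem hom_mem_rightOrder (hgr : C.IsGraded (M : Set A)) {g : G} {x : K}
    (h : ∀ k y, y ≠ 0 → C.hom k y ∈ M → C.hom k y * C.hom g x ∈ M) :
    C.hom g x ∈ rightOrder M := by
  intro m hm
  rw [← C.sum_coeff m, Finset.sum_mul]
  refine M.sum_mem fun k _ => ?_
  by_cases h0 : C.coeff m k = 0
  · simp [h0]
  · exact h k _ h0 (hgr.hom_coeff_mem hm k)

theorem isGraded_rightOrder (hgr : C.IsGraded (M : Set A)) :
    C.IsGraded (rightOrder M : Set A) := by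
  refine C.isGraded_of_hom_coeff_mem fun a ha g => hom_mem_rightOrder hgr fun k y _ hy => ?_
  have := hgr.hom_coeff_mem (ha _ hy) (k * g)
  rwa [coeff_hom_mul, ← hom_mul_hom] at this

end Coefficients

/-! ### Full graded lattices described by their components -/

section Lattices

variable {R K G A : Type*} [CommRing R] [Field K] [Algebra R K] [IsFractionRing R K]
  [Group G] [Fintype G] [MulSemiringAction G R] [Ring A]
  {C : CrystallineGraded R K G A} {D : AddSubgroup A}

theorem IsFullLattice.exists_hom_mem (hD : C.IsFullLattice D) (hgr : C.IsGraded (D : Set A))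
    (g : G) : ∃ x : K, x ≠ 0 ∧ C.hom g x ∈ D := by
  classical
  by_contra! h
  have key : ∀ a ∈ leftSpan C.incl (D : Set A), C.coeff a g = 0 := by
    intro a ha
    induction ha using AddSubgroup.closure_induction with
    | mem a ha =>
      obtain ⟨k, d, hd, rfl⟩ := ha
      have : C.coeff d g = 0 := by
        by_contra h0
        exact h _ h0 (hgr.hom_coeff_mem hd g)
      rw [coeff_incl_mul, this, mul_zero]
    | zero => simp [coeff_zero]
    | add a b _ _ ha hb => simp [coeff_add, ha, hb]
    | neg a _ ha => simp [coeff_neg, ha]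
  have := key (C.hom g 1) (by rw [hD.left_full]; trivial)
  simp [coeff_hom] at this

/-- A common denominator of the degree `g` coefficients of finitely many left generators serves for
all of `D`. -/
theorem IsFullLattice.exists_bound [IsDomain R] (hD : C.IsFullLattice D) (g : G) :
    ∃ c : K, c ≠ 0 ∧ ∀ x : K, C.hom g x ∈ D → ∃ r : R, c * x = algebraMap R K r := by
  classical
  obtain ⟨S, hS⟩ := hD.fg_left
  obtain ⟨d, hd⟩ := IsLocalization.exist_integer_multiples_of_finset R⁰
    (S.image fun s => C.coeff s g)
  have hd0 : algebraMap R K d ≠ 0 := by simp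
  refine ⟨algebraMap R K d, hd0, fun x hx => ?_⟩
  have key : ∀ a ∈ leftSpan C.inclR (S : Set A),
      ∃ r : R, algebraMap R K d * C.coeff a g = algebraMap R K r := by
    intro a ha
    induction ha using AddSubgroup.closure_induction with
    | mem a ha =>
      obtain ⟨r, s, hs, rfl⟩ := ha
      obtain ⟨t, ht⟩ := hd (C.coeff s g) (Finset.mem_image_of_mem _ hs)
      refine ⟨r * t, ?_⟩
      rw [inclR, RingHom.comp_apply, coeff_incl_mul, map_mul, ht, Algebra.smul_def]
      ring
    | zero => exact ⟨0, by simp [coeff_zero]⟩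
    | add a b _ _ ha hb =>
      obtain ⟨r, hr⟩ := ha
      obtain ⟨s, hs⟩ := hb
      exact ⟨r + s, by rw [coeff_add, Pi.add_apply, mul_add, hr, hs, map_add]⟩
    | neg a _ ha =>
      obtain ⟨r, hr⟩ := ha
      exact ⟨-r, by rw [coeff_neg, Pi.neg_apply, mul_neg, hr, map_neg]⟩
  have := key (C.hom g x) (by rw [hS]; exact hx)
  simpa [coeff_hom] using this

/-- The coefficients of the elements of degree `g` of a left `R`-submodule of `A`. -/
def component (hR : ∀ (r : R), ∀ m ∈ D, C.inclR r * m ∈ D) (g : G) : Submodule R K where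
  carrier := {x | C.hom g x ∈ D}
  add_mem' {x y} hx hy := by
    simp only [Set.mem_ofPred_eq, hom_add] at *
    exact D.add_mem hx hy
  zero_mem' := by simp [D.zero_mem]
  smul_mem' r x hx := by
    have := hR r _ hx
    rwa [inclR, RingHom.comp_apply, incl_mul_hom, ← Algebra.smul_def] at this

theorem mem_component {hR : ∀ (r : R), ∀ m ∈ D, C.inclR r * m ∈ D} {g : G} {x : K} :
    x ∈ component hR g ↔ C.hom g x ∈ D := Iff.rfl

theorem isFractional_component [IsDomain R] (hR : ∀ (r : R), ∀ m ∈ D, C.inclR r * m ∈ D) {g : G} {c : K}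
    (hc : c ≠ 0) (hb : ∀ x : K, C.hom g x ∈ D → ∃ r : R, c * x = algebraMap R K r) :
    IsFractional R⁰ (component hR g) := by
  obtain ⟨a, s, hs, rfl⟩ := IsFractionRing.div_surjective R c
  have ha : a ≠ 0 := fun h => hc (by simp [h])
  have hs' : algebraMap R K s ≠ 0 := by simpa using nonZeroDivisors.ne_zero hs
  refine ⟨a, mem_nonZeroDivisors_of_ne_zero ha, fun x hx => ?_⟩
  obtain ⟨r, hr⟩ := hb x hx
  refine ⟨s * r, ?_⟩
  rw [map_mul, ← hr, Algebra.smul_def]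
  field_simp

/-- A nonzero component with a common denominator is a fractional ideal, hence finitely generated
since `R` is Noetherian. The same generators serve on both sides, because moving `r` across `u_g`
only replaces it by `g • r`. This is the criterion by which every lattice below is recognized. -/
theorem isFullLattice_of_bounds [IsDedekindDomain R] (hgr : C.IsGraded (D : Set A))
    (hR : ∀ (r : R), ∀ m ∈ D, C.inclR r * m ∈ D)
    (hne : ∀ g, ∃ x : K, x ≠ 0 ∧ C.hom g x ∈ D)
    (hb : ∀ g, ∃ c : K, c ≠ 0 ∧ ∀ x : K, C.hom g x ∈ D → ∃ r : R, c * x = algebraMap R K r) :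
    C.IsFullLattice D := by
  classical
  have hfg (g : G) : (component hR g).FG := by
    obtain ⟨c, hc, h⟩ := hb g
    exact fg_of_isNoetherianRing (le_refl R⁰)
      (⟨component hR g, isFractional_component hR hc h⟩ : FractionalIdeal R⁰ K)
  choose T hT using hfg
  have hTD (g : G) {x : K} (hx : x ∈ T g) : C.hom g x ∈ D := by
    rw [← mem_component (hR := hR), ← hT g]
    exact Submodule.subset_span hx
  have hcomm (g : G) (x : K) (r : R) :
      C.hom g x * C.inclR r = C.inclR (g • r) * C.hom g x := by
    rw [inclR, RingHom.comp_apply, RingHom.comp_apply, hom_mul_incl, incl_mul_hom,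
      fracAut_algebraMap, mul_comm]
  have hRr : ∀ (r : R), ∀ m ∈ D, m * C.inclR r ∈ D := by
    intro r m hm
    rw [← C.sum_coeff m, Finset.sum_mul]
    refine D.sum_mem fun g _ => ?_
    rw [hcomm]
    exact hR _ _ (hgr.hom_coeff_mem hm g)
  have hgen {E : AddSubgroup A} (hE : ∀ g, ∀ x ∈ T g, ∀ r : R, C.inclR r * C.hom g x ∈ E) :
      D ≤ E := by
    intro a ha
    refine C.mem_of_hom_coeff_mem fun g => ?_
    have hx : C.coeff a g ∈ Submodule.span R (T g : Set K) := by
      rw [hT g]; exact hgr.hom_coeff_mem ha g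
    generalize C.coeff a g = x at hx
    induction hx using Submodule.closure_induction with
    | zero => simp [E.zero_mem]
    | add x y _ _ hx hy => rw [hom_add]; exact E.add_mem hx hy
    | smul_mem r x hx =>
      rw [Algebra.smul_def, ← incl_mul_hom]
      exact hE g x hx r
  set S : Finset A := Finset.univ.biUnion fun g => (T g).image (C.hom g) with hS
  have hmemS {g : G} {x : K} (hx : x ∈ T g) : C.hom g x ∈ (S : Set A) := by
    simp only [hS, Finset.coe_biUnion, Finset.coe_image, Set.mem_iUnion]
    exact ⟨g, by simp, x, hx, rfl⟩
  have hSD {s : A} (hs : s ∈ (S : Set A)) : s ∈ D := by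
    simp only [hS, Finset.coe_biUnion, Finset.coe_image, Set.mem_iUnion] at hs
    obtain ⟨g, -, x, hx, rfl⟩ := hs
    exact hTD g hx
  refine ⟨⟨hR, hRr, ?_, ?_, ?_, ⟨S, le_antisymm ?_ ?_⟩, ⟨S, le_antisymm ?_ ?_⟩⟩, ?_, ?_⟩
  · intro a ha m _
    refine C.ext_coeff (funext fun g => ?_)
    rw [inclR, RingHom.comp_apply, coeff_incl_mul, coeff_mul_incl, fracAut_algebraMap, ha, mul_comm]
  · intro r m _ h
    refine or_iff_not_imp_left.mpr fun hr => C.ext_coeff (funext fun g => ?_)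
    have := congrFun (congrArg C.coeff h) g
    rw [inclR, RingHom.comp_apply, coeff_incl_mul, coeff_zero] at this
    rw [coeff_zero]
    exact (mul_eq_zero.mp this).resolve_left (by simpa using hr)
  · intro r m _ h
    refine or_iff_not_imp_left.mpr fun hr => C.ext_coeff (funext fun g => ?_)
    have := congrFun (congrArg C.coeff h) g
    rw [inclR, RingHom.comp_apply, coeff_mul_incl, coeff_zero] at this
    rw [coeff_zero]
    exact (mul_eq_zero.mp this).resolve_right (by simpa using hr)
  · refine (AddSubgroup.closure_le _).mpr ?_
    rintro _ ⟨r, s, hs, rfl⟩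
    exact hR r s (hSD hs)
  · exact hgen fun g x hx r => AddSubgroup.subset_closure ⟨r, _, hmemS hx, rfl⟩
  · refine (AddSubgroup.closure_le _).mpr ?_
    rintro _ ⟨r, s, hs, rfl⟩
    exact hRr r s (hSD hs)
  · refine hgen fun g x hx r => AddSubgroup.subset_closure ⟨g⁻¹ • r, _, hmemS hx, ?_⟩
    rw [hcomm, smul_inv_smul]
  · refine eq_top_iff.mpr fun a _ => C.mem_of_hom_coeff_mem fun g => ?_
    obtain ⟨x, hx0, hx⟩ := hne g
    refine AddSubgroup.subset_closure ⟨C.coeff a g / x, _, hx, ?_⟩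
    rw [incl_mul_hom, div_mul_cancel₀ _ hx0]
  · refine eq_top_iff.mpr fun a _ => C.mem_of_hom_coeff_mem fun g => ?_
    obtain ⟨x, hx0, hx⟩ := hne g
    refine AddSubgroup.subset_closure ⟨(fracAut R K g).symm (C.coeff a g / x), _, hx, ?_⟩
    rw [hom_mul_incl, RingEquiv.apply_symm_apply, mul_div_cancel₀ _ hx0]

end Lattices

end CrystallineGraded

/-! ### Subadditive functions and potentials on the action groupoid -/

section Potentials

/-- The rounding principle: an integer below `c + n` is at most every member of its class that is at
least `c`. -/
theorem Int.le_of_modEq_of_lt_add {a b c n : ℤ} (h : a ≡ b [ZMOD n]) (ha : a < c + n)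
    (hb : c ≤ b) : a ≤ b := by
  by_contra! hlt
  have := Int.le_of_dvd (by lia) h.symm.dvd
  lia

variable {G S : Type*} [Group G] [MulAction G S]

/-- A subadditive function on the arrows `Q → g • Q` is bounded below by a potential. -/
theorem exists_potential [Fintype G] {f : G → S → ℤ}
    (hf : ∀ g h Q, f (g * h) Q ≤ f g (h • Q) + f h Q) (P : S) :
    ∃ p : S → ℤ, (∀ g, ∀ Q ∈ MulAction.orbit G P, p (g • Q) - p Q ≤ f g Q) ∧
      ∀ Q ∈ MulAction.orbit G P, ∃ h, h • P = Q ∧ p Q = f h P := by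
  classical
  -- The potential at `Q` is the least value of `f` on arrows `P → Q`; off the orbit there are none
  -- and `0` is a dummy value.
  have hmin (Q : S) : ∃ z : ℤ, Q ∈ MulAction.orbit G P →
      (∃ h : G, h • P = Q ∧ z = f h P) ∧ ∀ h : G, h • P = Q → z ≤ f h P := by
    by_cases hQ : Q ∈ MulAction.orbit G P
    · obtain ⟨k, hk⟩ := hQ
      obtain ⟨h, hh, hle⟩ := Finset.exists_min_image
        (Finset.univ.filter fun h : G => h • P = Q) (fun h => f h P) ⟨k, by simpa using hk⟩
      exact ⟨f h P, fun _ => ⟨⟨h, by simpa using hh, rfl⟩, fun k hk => hle k (by simpa using hk)⟩⟩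
    · exact ⟨0, fun h => absurd h hQ⟩
  choose p hp using hmin
  refine ⟨p, fun g Q hQ => ?_, fun Q hQ => (hp Q hQ).1⟩
  obtain ⟨h, hh, hpQ⟩ := (hp Q hQ).1
  have h1 := (hp (g • Q) (MulAction.mem_orbit_of_mem_orbit g hQ)).2 (g * h) (by rw [mul_smul, hh])
  have h2 := hf g h P
  rw [hh] at h2
  lia

variable {n : ℤ} {B : G → S → ℤ}

/-- The potential difference of two points is the value of some arrow between them. -/
theorem exists_eq_potential_sub {f : G → S → ℤ} {p : S → ℤ} {P : S}
    (hB : ∀ g h Q, B (g * h) Q ≡ B g (h • Q) + B h Q [ZMOD n])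
    (hfB : ∀ g Q, f g Q ≡ B g Q [ZMOD n])
    (hle : ∀ g, ∀ Q ∈ MulAction.orbit G P, p (g • Q) - p Q ≤ f g Q)
    (hlt : ∀ g, ∀ Q ∈ MulAction.orbit G P, f g Q < p (g • Q) - p Q + n)
    (hp : ∀ Q ∈ MulAction.orbit G P, ∃ h, h • P = Q ∧ p Q = f h P)
    {Q Q' : S} (hQ : Q ∈ MulAction.orbit G P) (hQ' : Q' ∈ MulAction.orbit G P) :
    ∃ g : G, g • Q = Q' ∧ f g Q = p Q' - p Q := by
  obtain ⟨h, hh, hpQ⟩ := hp Q hQ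
  obtain ⟨h', hh', hpQ'⟩ := hp Q' hQ'
  have hg : (h' * h⁻¹) • Q = Q' := by rw [← hh, mul_smul, inv_smul_smul, hh']
  -- The arrow through `P` has value congruent to `p Q' - p Q`, and only one integer in the window
  -- of length `n` is.
  refine ⟨h' * h⁻¹, hg, le_antisymm ?_ ?_⟩
  · have h1 := hB (h' * h⁻¹) h P
    rw [inv_mul_cancel_right, hh] at h1
    have h2 : f (h' * h⁻¹) Q + f h P ≡ f h' P [ZMOD n] :=
      (((hfB _ _).add (hfB _ _)).trans h1.symm).trans (hfB _ _).symm
    have h3 := hlt (h' * h⁻¹) Q hQ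
    rw [hg] at h3
    have := Int.le_of_modEq_of_lt_add (c := f h' P) h2 (by lia) le_rfl
    lia
  · have := hle (h' * h⁻¹) Q hQ
    rwa [hg] at this

/-- On the orbit of `P`, `m g Q` is the least integer in the class of `B g Q` modulo `n` that is at
least `p (g • Q) - q Q`, and `p Q' - q Q` lies in the class of some arrow `Q → Q'`. -/
structure IsPotentialPair (n : ℤ) (m : G → S → ℤ) (P : S) (p q : S → ℤ) : Prop where
  le : ∀ g, ∀ Q ∈ MulAction.orbit G P, p (g • Q) - q Q ≤ m g Q
  lt : ∀ g, ∀ Q ∈ MulAction.orbit G P, m g Q < p (g • Q) - q Q + n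
  exists_eq : ∀ Q ∈ MulAction.orbit G P, ∀ Q' ∈ MulAction.orbit G P,
    ∃ g : G, g • Q = Q' ∧ m g Q = p Q' - q Q

/-- The lower bound forces `q Q` to be at least the maximum of `p (h • Q) - m h Q` over `h`, and
this maximum works: composing a maximizing arrow with arrows controlled by `f` gives the upper bound
and the attained values. -/
theorem IsPotentialPair.of_module [Fintype G] {f m : G → S → ℤ} {P : S} {p : S → ℤ}
    (hf : IsPotentialPair n f P p p) (hm : ∀ g h Q, m (g * h) Q ≤ f g (h • Q) + m h Q) :
    ∃ q, IsPotentialPair n m P p q := by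
  have hmax (Q : S) : ∃ h : G, ∀ k : G, p (k • Q) - m k Q ≤ p (h • Q) - m h Q := by
    obtain ⟨h, -, hh⟩ := Finset.exists_max_image (Finset.univ : Finset G)
      (fun h => p (h • Q) - m h Q) ⟨1, Finset.mem_univ 1⟩
    exact ⟨h, fun k => hh k (Finset.mem_univ k)⟩
  choose t ht using hmax
  refine ⟨fun Q => p (t Q • Q) - m (t Q) Q, fun g Q _ => ?_, fun g Q hQ => ?_,
    fun Q hQ Q' hQ' => ?_⟩
  · have := ht Q g
    lia
  · have h1 := hm (g * (t Q)⁻¹) (t Q) Q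
    have h2 := hf.lt (g * (t Q)⁻¹) (t Q • Q) (MulAction.mem_orbit_of_mem_orbit _ hQ)
    rw [inv_mul_cancel_right] at h1
    rw [mul_smul, inv_smul_smul] at h2
    lia
  · obtain ⟨a, ha, hfa⟩ := hf.exists_eq (t Q • Q) (MulAction.mem_orbit_of_mem_orbit _ hQ) Q' hQ'
    have hg : (a * t Q) • Q = Q' := by rw [mul_smul, ha]
    have h1 := hm a (t Q) Q
    have h2 := ht Q (a * t Q)
    rw [hg] at h2
    exact ⟨a * t Q, hg, by lia⟩

/-- A loop has finite order, so subadditivity gives `0 ≤ f 1 Q ≤ |G| * f s Q`. -/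
theorem nonneg_of_smul_eq [Fintype G] {f : G → S → ℤ}
    (hf : ∀ g h Q, f (g * h) Q ≤ f g (h • Q) + f h Q) {s : G} {Q : S} (hs : s • Q = Q) :
    0 ≤ f s Q := by
  have h1 : 0 ≤ f 1 Q := by
    have := hf 1 1 Q
    rw [mul_one, one_smul] at this
    lia
  have hpow (k : ℕ) : f (s ^ (k + 1)) Q ≤ (k + 1) * f s Q := by
    induction k with
    | zero => simp
    | succ k ih =>
      have := hf (s ^ (k + 1)) s Q
      rw [hs, ← pow_succ] at this
      push_cast
      linarith
  obtain ⟨k, hk⟩ := Nat.exists_eq_succ_of_ne_zero (Fintype.card_ne_zero (α := G))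
  have h2 := hpow k
  rw [← Nat.succ_eq_add_one, ← hk, pow_card_eq_one] at h2
  by_contra! hneg
  nlinarith

/-- A subadditive function that is small on suitable arrows is bounded below by the potential `q`
belonging to the sources of the arrows. -/
theorem IsPotentialPair.sub_le [Fintype G] {m c : G → S → ℤ} {P : S} {p q : S → ℤ}
    (hm : IsPotentialPair n m P p q)
    (hB : ∀ g h Q, B (g * h) Q ≡ B g (h • Q) + B h Q [ZMOD n])
    (hmB : ∀ g Q, m g Q ≡ B g Q [ZMOD n])
    (hc : ∀ g h Q, c (g * h) Q ≤ c g (h • Q) + c h Q)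
    (hcq : ∀ b, ∀ Q ∈ MulAction.orbit G P, B b Q ≡ q (b • Q) - q Q [ZMOD n] →
      c b Q ≤ q (b • Q) - q Q)
    (g : G) {Q : S} (hQ : Q ∈ MulAction.orbit G P) : q (g • Q) - q Q ≤ c g Q := by
  have hQ' := MulAction.mem_orbit_of_mem_orbit g hQ
  obtain ⟨a, ha, hma⟩ := hm.exists_eq Q hQ P (MulAction.mem_orbit_self P)
  obtain ⟨a', ha', hma'⟩ := hm.exists_eq (g • Q) hQ' P (MulAction.mem_orbit_self P)
  -- The arrow `a⁻¹ * a'` returns from `g • Q` to `Q` via `P`. As `m` equals the potential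
  -- difference on `a` and `a'`, the class of the return arrow contains `q Q - q (g • Q)`, so `hcq`
  -- applies to it.
  have hb : (a⁻¹ * a') • g • Q = Q := by rw [mul_smul, ha', ← ha, inv_smul_smul]
  have hBb := hB a (a⁻¹ * a') (g • Q)
  rw [mul_inv_cancel_left, hb] at hBb
  have hmod : B (a⁻¹ * a') (g • Q) ≡ q ((a⁻¹ * a') • g • Q) - q (g • Q) [ZMOD n] := by
    have h1 := ((hmB a' (g • Q)).trans hBb).sub (hmB a Q)
    rw [add_sub_cancel_left, hma, hma'] at h1
    rw [hb]
    convert h1.symm using 1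
    ring
  have h1 := hcq _ _ hQ' hmod
  rw [hb] at h1
  have h2 := hc g (a⁻¹ * a') (g • Q)
  rw [hb] at h2
  have h3 := nonneg_of_smul_eq hc (s := g * (a⁻¹ * a')) (Q := g • Q) (by rw [mul_smul, hb])
  lia

end Potentials

/-! ### Weights of homogeneous elements -/

namespace CrystallineGraded

variable {R K G A : Type*} [CommRing R] [IsDedekindDomain R] [Field K] [Algebra R K]
  [IsFractionRing R K] [Group G] [Fintype G] [MulSemiringAction G R] [Ring A]

section Weight

variable (C : CrystallineGraded R K G A)

/-- The sum over `k` of the valuations of `α(g,k)` at `g • Q`. -/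
noncomputable def cocycleWeight (g : G) (Q : HeightOneSpectrum R) : ℤ :=
  ∑ k, ordAt K (g • Q) (C.α g k)

/-- The weight of `x u_g` at `Q`: the valuation at `g • Q` of the determinant of the left
multiplication by `x u_g`. -/
noncomputable def weight (g : G) (Q : HeightOneSpectrum R) (x : K) : ℤ :=
  Fintype.card G * ordAt K (g • Q) x + C.cocycleWeight g Q

theorem card_pos : (0 : ℤ) < Fintype.card G := by exact_mod_cast Fintype.card_pos

theorem weight_modEq (g : G) (Q : HeightOneSpectrum R) (x : K) :
    C.weight g Q x ≡ C.cocycleWeight g Q [ZMOD Fintype.card G] := by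
  simp [weight, Int.ModEq]

/-- The valuation of the 2-cocycle identity at `(g * h) • Q`, summed over `k` and reindexed by `k ↦
h * k`: `n` times the valuation of `α` becomes a coboundary. -/
theorem cocycleWeight_mul (g h : G) (Q : HeightOneSpectrum R) :
    Fintype.card G * ordAt K ((g * h) • Q) (C.α g h) + C.cocycleWeight (g * h) Q =
      C.cocycleWeight g (h • Q) + C.cocycleWeight h Q := by
  have key (k : G) : ordAt K ((g * h) • Q) (C.α g h) + ordAt K ((g * h) • Q) (C.α (g * h) k) =
      ordAt K (g • h • Q) (C.α g (h * k)) + ordAt K (h • Q) (C.α h k) := by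
    rw [← ordAt_mul _ (C.α_ne_zero _ _) (C.α_ne_zero _ _), C.α_cocycle, mul_smul,
      ordAt_mul _ (by simpa using C.α_ne_zero h k) (C.α_ne_zero _ _),
      ordAt_smul_fracAut _ _ (C.α_ne_zero _ _), add_comm]
  have hsum := Finset.sum_congr (rfl : (Finset.univ : Finset G) = _) fun k _ => key k
  rw [Finset.sum_add_distrib, Finset.sum_add_distrib, Finset.sum_const, Finset.card_univ,
    nsmul_eq_mul] at hsum
  exact hsum.trans (congrArg₂ (· + ·)
    (Equiv.sum_comp (Equiv.mulLeft h) fun k => ordAt K (g • h • Q) (C.α g k)) rfl)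

theorem cocycleWeight_modEq (g h : G) (Q : HeightOneSpectrum R) :
    C.cocycleWeight (g * h) Q ≡ C.cocycleWeight g (h • Q) + C.cocycleWeight h Q
      [ZMOD Fintype.card G] := by
  rw [← cocycleWeight_mul]
  simp [Int.ModEq]

theorem weight_mul (g h : G) (Q : HeightOneSpectrum R) {x y : K} (hx : x ≠ 0) (hy : y ≠ 0) :
    C.weight (g * h) Q (x * fracAut R K g y * C.α g h) = C.weight g (h • Q) x + C.weight h Q y := by
  have hy' : fracAut R K g y ≠ 0 := by simpa using hy
  have := C.cocycleWeight_mul g h Q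
  rw [weight, ordAt_mul _ (mul_ne_zero hx hy') (C.α_ne_zero g h), ordAt_mul _ hx hy', mul_smul,
    ordAt_smul_fracAut _ _ hy, weight, weight]
  rw [mul_smul] at this
  linear_combination this

theorem weight_one_one (Q : HeightOneSpectrum R) : C.weight 1 Q 1 = 0 := by
  simp [weight, cocycleWeight, α_one_left, ordAt_one]

theorem weight_scale (g : G) (Q : HeightOneSpectrum R) {x y : K} (hx : x ≠ 0) (hy : y ≠ 0) :
    C.weight g Q (x * y) = Fintype.card G * ordAt K (g • Q) x + C.weight g Q y := by
  rw [weight, ordAt_mul _ hx hy, weight]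
  ring

theorem weight_le_weight_scale (g : G) (Q : HeightOneSpectrum R) {x y : K} (hx : x ≠ 0)
    (hy : y ≠ 0) (h : 0 ≤ ordAt K (g • Q) x) : C.weight g Q y ≤ C.weight g Q (x * y) := by
  rw [weight_scale _ _ _ hx hy]
  have := mul_nonneg (card_pos (G := G)).le h
  lia

theorem le_weight_add {c : ℤ} {g : G} {Q : HeightOneSpectrum R} {x y : K} (hxy : x + y ≠ 0)
    (hx : x ≠ 0 → c ≤ C.weight g Q x) (hy : y ≠ 0 → c ≤ C.weight g Q y) :
    c ≤ C.weight g Q (x + y) := by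
  -- A bound on the weight is a bound on the valuation, by `(c - cocycleWeight) / n` rounded up; the
  -- two signs turn floor division into a ceiling.
  have key (z : K) : c ≤ C.weight g Q z ↔
      -((C.cocycleWeight g Q - c) / Fintype.card G) ≤ ordAt K (g • Q) z := by
    rw [neg_le, Int.le_ediv_iff_mul_le card_pos, weight]
    constructor <;> intro h <;> linarith
  rw [key] at hx hy ⊢
  exact le_ordAt_add hxy hx hy

end Weight

/-! ### Levels of graded lattices, and lattices cut out by weights -/

section Level

variable {C : CrystallineGraded R K G A}

/-- `f g Q` is the least weight at `Q` of an element `x u_g` of `D`, and these least weights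
determine the homogeneous elements of `D`. -/
structure IsLevel (C : CrystallineGraded R K G A) (D : AddSubgroup A)
    (f : G → HeightOneSpectrum R → ℤ) : Prop where
  mem_iff : ∀ g x, x ≠ 0 → (C.hom g x ∈ D ↔ ∀ Q, f g Q ≤ C.weight g Q x)
  exists_eq : ∀ g Q, ∃ x, x ≠ 0 ∧ C.hom g x ∈ D ∧ C.weight g Q x = f g Q

theorem IsFullLattice.exists_isLevel {D : AddSubgroup A} (hD : C.IsFullLattice D)
    (hgr : C.IsGraded (D : Set A)) : ∃ f, C.IsLevel D f := by
  choose c hc hb using hD.exists_bound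
  let J (g : G) : FractionalIdeal R⁰ K :=
    ⟨component hD.mul_left_mem g, isFractional_component hD.mul_left_mem (hc g) (hb g)⟩
  have hmem (g : G) (x : K) : x ∈ J g ↔ C.hom g x ∈ D := Iff.rfl
  have hJ (g : G) : J g ≠ 0 := by
    obtain ⟨x, hx0, hx⟩ := hD.exists_hom_mem hgr g
    intro h
    have hx' : x ∈ J g := hx
    rw [h, mem_zero_iff] at hx'
    exact hx0 hx'
  refine ⟨fun g Q => Fintype.card G * count K (g • Q) (J g) + C.cocycleWeight g Q,
    fun g x hx => ?_, fun g Q => ?_⟩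
  · rw [← hmem, mem_iff_count_le_ordAt (hJ g) hx]
    simp only [weight, add_le_add_iff_right, mul_le_mul_iff_right₀ (card_pos (G := G))]
    exact ⟨fun h Q => h _, fun h P => by simpa using h (g⁻¹ • P)⟩
  · obtain ⟨x, hx, hx0, h⟩ := exists_ordAt_eq_count (hJ g) (g • Q)
    exact ⟨x, hx0, hx, by rw [weight, h]⟩

variable {D E F : AddSubgroup A} {d e f : G → HeightOneSpectrum R → ℤ}

theorem IsLevel.modEq (hD : C.IsLevel D d) (g : G) (Q : HeightOneSpectrum R) :
    d g Q ≡ C.cocycleWeight g Q [ZMOD Fintype.card G] := by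
  obtain ⟨x, -, -, h⟩ := hD.exists_eq g Q
  rw [← h]
  exact C.weight_modEq g Q x

theorem IsLevel.mul_le (hD : C.IsLevel D d) (hE : C.IsLevel E e) (hF : C.IsLevel F f)
    (h : ∀ a ∈ D, ∀ b ∈ E, a * b ∈ F) (g k : G) (Q : HeightOneSpectrum R) :
    f (g * k) Q ≤ d g (k • Q) + e k Q := by
  obtain ⟨x, hx0, hx, hxd⟩ := hD.exists_eq g (k • Q)
  obtain ⟨y, hy0, hy, hye⟩ := hE.exists_eq k Q
  have := h _ hx _ hy
  rw [hom_mul_hom, hF.mem_iff _ _ (C.hom_mul_coeff_ne_zero g k hx0 hy0)] at this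
  rw [← hxd, ← hye, ← C.weight_mul g k Q hx0 hy0]
  exact this Q

theorem IsLevel.mono (hD : C.IsLevel D d) (hE : C.IsLevel E e) (h : D ≤ E) (g : G)
    (Q : HeightOneSpectrum R) : e g Q ≤ d g Q := by
  obtain ⟨x, hx0, hx, hxd⟩ := hD.exists_eq g Q
  rw [← hxd]
  exact (hE.mem_iff g x hx0).1 (h hx) Q

variable (C) in
/-- The elements of `A` whose homogeneous components have weights bounded below by `c`. -/
def weightSubgroup (c : G → HeightOneSpectrum R → ℤ) : AddSubgroup A where
  carrier := {a | ∀ g Q, C.coeff a g ≠ 0 → c g Q ≤ C.weight g Q (C.coeff a g)}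
  zero_mem' g Q h := absurd (by rw [coeff_zero, Pi.zero_apply]) h
  add_mem' {a b} ha hb g Q h := by
    rw [coeff_add, Pi.add_apply] at h ⊢
    exact C.le_weight_add h (ha g Q) (hb g Q)
  neg_mem' {a} ha g Q h := by
    rw [coeff_neg, Pi.neg_apply] at h ⊢
    have := ha g Q (neg_ne_zero.mp h)
    rw [← neg_one_mul]
    refine this.trans (C.weight_le_weight_scale g Q (by simp) (neg_ne_zero.mp h) ?_)
    rw [← map_one (algebraMap R K), ← map_neg]
    exact ordAt_algebraMap_nonneg _ _

theorem hom_mem_weightSubgroup {c : G → HeightOneSpectrum R → ℤ} {g : G} {x : K} (hx : x ≠ 0) :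
    C.hom g x ∈ C.weightSubgroup c ↔ ∀ Q, c g Q ≤ C.weight g Q x := by
  classical
  change (∀ k Q, C.coeff (C.hom g x) k ≠ 0 → c k Q ≤ C.weight k Q (C.coeff (C.hom g x) k)) ↔ _
  rw [coeff_hom]
  refine ⟨fun h Q => by simpa [hx] using h g Q, fun h k Q hk => ?_⟩
  obtain rfl : k = g := by
    by_contra hne
    exact hk (Pi.single_eq_of_ne (M := fun _ => K) hne x)
  simpa using h Q

theorem isGraded_weightSubgroup (c : G → HeightOneSpectrum R → ℤ) :
    C.IsGraded (C.weightSubgroup c : Set A) := by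
  refine C.isGraded_of_hom_coeff_mem fun a ha g => ?_
  by_cases h : C.coeff a g = 0
  · rw [h, hom_zero]
    exact (C.weightSubgroup c).zero_mem
  · exact (hom_mem_weightSubgroup h).2 fun Q => ha g Q h

variable (C) in
/-- For a subadditive function the elements with weights bounded below by it form a ring. -/
def weightSubring (c : G → HeightOneSpectrum R → ℤ)
    (hc : ∀ g h Q, c (g * h) Q ≤ c g (h • Q) + c h Q) (h1 : ∀ Q, c 1 Q ≤ 0) : Subring A where
  __ := C.weightSubgroup c
  one_mem' := by
    change (1 : A) ∈ C.weightSubgroup c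
    rw [← C.hom_one_one, hom_mem_weightSubgroup one_ne_zero]
    simpa [weight_one_one] using h1
  mul_mem' {a b} ha hb := by
    change a * b ∈ C.weightSubgroup c
    rw [← C.sum_coeff a, ← C.sum_coeff b, Finset.sum_mul_sum]
    refine AddSubgroup.sum_mem _ fun g _ => AddSubgroup.sum_mem _ fun h _ => ?_
    by_cases hx : C.coeff a g = 0
    · simp [hx]
    by_cases hy : C.coeff b h = 0
    · simp [hy]
    rw [hom_mul_hom, hom_mem_weightSubgroup (C.hom_mul_coeff_ne_zero g h hx hy)]
    intro Q
    rw [C.weight_mul g h Q hx hy]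
    have h1 := ha g (h • Q) hx
    have h2 := hb h Q hy
    have h3 := hc g h Q
    lia

theorem IsLevel.le_weightSubgroup (hD : C.IsLevel D d) (hgr : C.IsGraded (D : Set A))
    {c : G → HeightOneSpectrum R → ℤ} (h : ∀ g Q, c g Q ≤ d g Q) : D ≤ C.weightSubgroup c :=
  fun _ ha g Q h0 => (h g Q).trans ((hD.mem_iff g _ h0).1 (hgr.hom_coeff_mem ha g) Q)

/-- Since `c` differs from `d` on one finite orbit only, a single nonzero element of `R` multiplies
the enlarged group back into `D`, which bounds its denominators. -/
theorem isFullLattice_weightSubgroup (hD : C.IsFullLattice D) (hgr : C.IsGraded (D : Set A))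
    (hd : C.IsLevel D d) {c : G → HeightOneSpectrum R → ℤ} (h : ∀ g Q, c g Q ≤ d g Q)
    {P : HeightOneSpectrum R} (hP : ∀ g, ∀ Q ∉ MulAction.orbit G P, c g Q = d g Q) :
    C.IsFullLattice (C.weightSubgroup c) := by
  have hle := hd.le_weightSubgroup hgr h
  obtain ⟨a, haP, ha0⟩ := Submodule.exists_mem_ne_zero_of_ne_bot P.ne_bot
  have hne (k : G) : algebraMap R K (k • a) ≠ 0 := by
    simpa using (smul_ne_zero_iff_ne k).mpr ha0
  -- The norm of a nonzero element of `P` lies in every ideal of the orbit.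
  set s : R := ∏ k : G, k • a with hs
  have hs0 : algebraMap R K s ≠ 0 := by
    rw [hs, map_prod]
    exact Finset.prod_ne_zero_iff.mpr fun k _ => hne k
  have hsP : ∀ Q ∈ MulAction.orbit G P, 1 ≤ ordAt K Q (algebraMap R K s) := by
    rintro _ ⟨k, rfl⟩
    have h1 : ((1 : ℕ) : ℤ) ≤ ordAt K (k • P) (algebraMap R K (k • a)) := by
      rw [ordAt_smul_algebraMap _ _ ha0, le_ordAt_algebraMap_iff _ ha0, pow_one]
      exact haP
    rw [hs, map_prod, ordAt_prod _ _ _ hne]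
    exact le_trans (by exact_mod_cast h1) (Finset.single_le_sum
      (f := fun k' => ordAt K (k • P) (algebraMap R K (k' • a)))
      (fun i _ => ordAt_algebraMap_nonneg _ _) (Finset.mem_univ k))
  -- Any common bound for the finitely many gaps `d - c` on the orbit will do; a sum avoids choosing
  -- a maximum.
  set N : ℕ := ∑ g : G, ∑ k : G, (d g (k • P) - c g (k • P)).toNat with hN
  have hNle (g k : G) : d g (k • P) - c g (k • P) ≤ N := by
    have h1 : (d g (k • P) - c g (k • P)).toNat ≤ N := by
      refine le_trans ?_ (Finset.single_le_sum
        (f := fun g => ∑ k : G, (d g (k • P) - c g (k • P)).toNat)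
        (fun i _ => Nat.zero_le _) (Finset.mem_univ g))
      exact Finset.single_le_sum (f := fun k => (d g (k • P) - c g (k • P)).toNat)
        (fun i _ => Nat.zero_le _) (Finset.mem_univ k)
    lia
  have hscale (g : G) (x : K) (hx0 : x ≠ 0) (hx : C.hom g x ∈ C.weightSubgroup c) :
      C.hom g (algebraMap R K s ^ N * x) ∈ D := by
    rw [hd.mem_iff _ _ (mul_ne_zero (pow_ne_zero N hs0) hx0)]
    intro Q
    have hxQ := (hom_mem_weightSubgroup hx0).1 hx Q
    by_cases hQ : Q ∈ MulAction.orbit G P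
    · have h1 := hsP _ (MulAction.mem_orbit_of_mem_orbit g hQ)
      obtain ⟨k, rfl⟩ := hQ
      rw [C.weight_scale g _ (pow_ne_zero N hs0) hx0, ordAt_pow]
      have h2 := hNle g k
      have h3 : (N : ℤ) ≤ N * ordAt K (g • k • P) (algebraMap R K s) :=
        le_mul_of_one_le_right (by positivity) h1
      have h4 : (N * ordAt K (g • k • P) (algebraMap R K s) : ℤ) ≤
          Fintype.card G * (N * ordAt K (g • k • P) (algebraMap R K s)) :=
        le_mul_of_one_le_left (by lia) (card_pos (G := G))
      change c g (k • P) ≤ C.weight g (k • P) x at hxQ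
      change d g (k • P) ≤ Fintype.card G * (N * ordAt K (g • k • P) (algebraMap R K s)) +
        C.weight g (k • P) x
      lia
    · rw [hP g Q hQ] at hxQ
      refine hxQ.trans (C.weight_le_weight_scale g Q (pow_ne_zero N hs0) hx0 ?_)
      rw [ordAt_pow]
      exact mul_nonneg (by positivity) (ordAt_algebraMap_nonneg _ _)
  refine isFullLattice_of_bounds (isGraded_weightSubgroup c) (fun r a ha => ?_) (fun g => ?_)
    fun g => ?_
  · intro g Q h0
    rw [inclR, RingHom.comp_apply, coeff_incl_mul] at h0 ⊢
    have h0' := mul_ne_zero_iff.mp h0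
    exact (ha g Q h0'.2).trans
      (C.weight_le_weight_scale g Q h0'.1 h0'.2 (ordAt_algebraMap_nonneg _ _))
  · obtain ⟨x, hx0, hx⟩ := hD.exists_hom_mem hgr g
    exact ⟨x, hx0, hle hx⟩
  · obtain ⟨b, hb0, hb⟩ := hD.exists_bound g
    refine ⟨b * algebraMap R K s ^ N, mul_ne_zero hb0 (pow_ne_zero N hs0), fun x hx => ?_⟩
    by_cases hx0 : x = 0
    · exact ⟨0, by simp [hx0]⟩
    · rw [mul_assoc]
      exact hb _ (hscale g x hx0 hx)

end Level

end CrystallineGraded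

/-! ### Gr-maximal orders and the right order -/

namespace CrystallineGraded

variable {R K G A : Type*} [CommRing R] [IsDedekindDomain R] [Field K] [Algebra R K]
  [IsFractionRing R K] [Group G] [Fintype G] [MulSemiringAction G R] [Ring A]
  {C : CrystallineGraded R K G A}

theorem IsLevel.subadditive {Λ : Subring A} {f : G → HeightOneSpectrum R → ℤ}
    (hf : C.IsLevel Λ.toAddSubgroup f) (g h : G) (Q : HeightOneSpectrum R) :
    f (g * h) Q ≤ f g (h • Q) + f h Q :=
  hf.mul_le hf hf (fun _ ha _ hb => Λ.mul_mem ha hb) g h Q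

/-- The level of a gr-maximal order is given by a potential on every orbit of maximal ideals. -/
theorem IsGrMaximalOrder.exists_isPotentialPair {Λ : Subring A} (hΛ : C.IsGrMaximalOrder Λ)
    {f : G → HeightOneSpectrum R → ℤ} (hf : C.IsLevel Λ.toAddSubgroup f)
    (P : HeightOneSpectrum R) : ∃ p, IsPotentialPair (Fintype.card G) f P p p := by
  classical
  have hsub := hf.subadditive
  obtain ⟨p, hp, hp'⟩ := exists_potential hsub P
  -- Only one orbit is altered, so that the enlarged ring is still a lattice.
  set c : G → HeightOneSpectrum R → ℤ := fun g Q =>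
    if Q ∈ MulAction.orbit G P then p (g • Q) - p Q else f g Q with hc
  have hcin (g : G) {Q} (hQ : Q ∈ MulAction.orbit G P) : c g Q = p (g • Q) - p Q := if_pos hQ
  have hcout (g : G) {Q} (hQ : Q ∉ MulAction.orbit G P) : c g Q = f g Q := if_neg hQ
  have hcf (g : G) (Q) : c g Q ≤ f g Q := by
    by_cases hQ : Q ∈ MulAction.orbit G P
    · rw [hcin g hQ]; exact hp g Q hQ
    · rw [hcout g hQ]
  have hcsub (g h : G) (Q) : c (g * h) Q ≤ c g (h • Q) + c h Q := by
    by_cases hQ : Q ∈ MulAction.orbit G P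
    · rw [hcin _ hQ, hcin _ hQ, hcin _ (MulAction.mem_orbit_of_mem_orbit h hQ), mul_smul]
      lia
    · have hQ' : h • Q ∉ MulAction.orbit G P := fun h' => hQ <| by
        simpa using MulAction.mem_orbit_of_mem_orbit h⁻¹ h'
      rw [hcout _ hQ, hcout _ hQ, hcout _ hQ']
      exact hsub g h Q
  have hc1 (Q) : c 1 Q ≤ 0 := by
    refine (hcf 1 Q).trans ?_
    rw [← C.weight_one_one Q]
    refine (hf.mem_iff 1 1 one_ne_zero).1 ?_ Q
    rw [hom_one_one]
    exact Λ.one_mem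
  have hgr : C.IsGraded (Λ.toAddSubgroup : Set A) := hΛ.prop.isGraded
  have hle : Λ ≤ C.weightSubring c hcsub hc1 := fun a ha => hf.le_weightSubgroup hgr hcf ha
  have hord : C.IsGrOrder (C.weightSubring c hcsub hc1) :=
    ⟨isFullLattice_weightSubgroup hΛ.prop.isFullLattice hgr hf hcf fun g Q hQ => hcout g hQ,
      isGraded_weightSubgroup c⟩
  have hge := hΛ.le_of_ge hord hle
  have hlt (g : G) (Q) (hQ : Q ∈ MulAction.orbit G P) :
      f g Q < p (g • Q) - p Q + Fintype.card G := by
    -- Multiplying a minimal element by `t` lowers its weight at `Q` by exactly `n` and nowhere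
    -- else. If there were room for this, the result would lie in the enlarged order, which is `Λ`,
    -- against the minimality of `f g Q`.
    by_contra! hlt
    obtain ⟨x, hx0, hx, hxf⟩ := hf.exists_eq g Q
    obtain ⟨t, ht0, ht, htQ⟩ := exists_ordAt_eq_neg_one (K := K) (g • Q)
    have hxt : C.weight g Q (t * x) = f g Q - Fintype.card G := by
      rw [C.weight_scale g Q ht0 hx0, ht, hxf]
      ring
    have hmem : C.hom g (t * x) ∈ C.weightSubgroup c := by
      rw [hom_mem_weightSubgroup (mul_ne_zero ht0 hx0)]
      intro Q'
      by_cases hQQ : Q' = Q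
      · rw [hQQ, hxt, hcin g hQ]
        lia
      · exact ((hcf g Q').trans ((hf.mem_iff g x hx0).1 hx Q')).trans
          (C.weight_le_weight_scale g Q' ht0 hx0
            (htQ _ fun h => hQQ (MulAction.injective g h)))
    have := (hf.mem_iff g _ (mul_ne_zero ht0 hx0)).1 (hge hmem) Q
    have := card_pos (G := G)
    lia
  exact ⟨p, hp, hlt, fun Q hQ Q' hQ' =>
    exists_eq_potential_sub C.cocycleWeight_modEq hf.modEq hp hlt hp' hQ hQ'⟩

variable {M : AddSubgroup A}

/-- Denominators are bounded because a nonzero degree `1` element of `M` multiplies `O_r(M)` into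
`M`. Nonzero elements of each degree exist because finitely many conditions, one for each component
of `M`, can be met by one multiple. -/
theorem isGrOrder_rightOrder (hM : C.IsFullLattice M) (hgr : C.IsGraded (M : Set A)) :
    C.IsGrOrder (rightOrder M) := by
  classical
  choose c hc hb using hM.exists_bound
  choose z hz0 hz using hM.exists_hom_mem hgr
  refine ⟨isFullLattice_of_bounds (isGraded_rightOrder hgr) (fun r a ha => ?_) (fun g => ?_)
    fun g => ?_, isGraded_rightOrder hgr⟩
  · exact (rightOrder M).mul_mem (fun m hm => hM.mul_right_mem r m hm) ha
  · have hk (k : G) : ∃ s : R, s ≠ 0 ∧ ∀ r : R, ∀ y, C.hom k y ∈ M →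
        C.hom (k * g) (y * algebraMap R K (s * r) * C.α k g) ∈ M := by
      obtain ⟨s, d, hd, hsd⟩ := IsFractionRing.div_surjective R (c k * z (k * g) / C.α k g)
      have hd0 : algebraMap R K d ≠ 0 := by simpa using nonZeroDivisors.ne_zero hd
      refine ⟨s, fun hs => ?_, fun r y hy => ?_⟩
      · rw [hs, map_zero, zero_div, eq_comm, div_eq_zero_iff, mul_eq_zero] at hsd
        exact hsd.elim (fun h => h.elim (hc k) (hz0 _)) (C.α_ne_zero k g)
      · obtain ⟨t, ht⟩ := hb k y hy
        have := hM.mul_left_mem (t * d * r) _ (hz (k * g))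
        rw [inclR, RingHom.comp_apply, incl_mul_hom] at this
        convert this using 2
        have hα := C.α_ne_zero k g
        rw [div_eq_div_iff hd0 hα] at hsd
        simp only [map_mul, ← ht]
        linear_combination y * algebraMap R K r * hsd
    choose s hs0 hs using hk
    -- Right multiplication past `u_k` twists coefficients by `k`, so the factors are untwisted
    -- beforehand: applying `k` turns the `k`-th one into `s k`.
    have hprod (k : G) : ∃ r : R, k • ∏ j : G, j⁻¹ • s j = s k * r := by
      rw [← Finset.mul_prod_erase _ _ (Finset.mem_univ k), smul_mul', smul_inv_smul]
      exact ⟨_, rfl⟩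
    refine ⟨algebraMap R K (∏ j : G, j⁻¹ • s j), ?_, hom_mem_rightOrder hgr fun k y _ hy => ?_⟩
    · have : ∏ j : G, j⁻¹ • s j ≠ 0 :=
        Finset.prod_ne_zero_iff.mpr fun j _ => (smul_ne_zero_iff_ne _).mpr (hs0 j)
      rwa [ne_eq, IsFractionRing.to_map_eq_zero_iff]
    · obtain ⟨r, hr⟩ := hprod k
      rw [hom_mul_hom, fracAut_algebraMap, hr]
      exact hs k r y hy
  · refine ⟨c g * z 1, mul_ne_zero (hc g) (hz0 1), fun x hx => ?_⟩
    have := hx _ (hz 1)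
    rw [hom_mul_hom, one_mul, fracAut_one, α_one_left, mul_one] at this
    rw [mul_assoc]
    exact hb g _ this

theorem isGrMaximalOrder_rightOrder (hM : C.IsFullLattice M) (hgr : C.IsGraded (M : Set A))
    (hl : C.IsGrMaximalOrder (leftOrder M)) : C.IsGrMaximalOrder (rightOrder M) := by
  have hr := isGrOrder_rightOrder hM hgr
  obtain ⟨m, hm⟩ := hM.exists_isLevel hgr
  obtain ⟨f, hf⟩ := hl.prop.isFullLattice.exists_isLevel hl.prop.isGraded
  obtain ⟨f', hf'⟩ := hr.isFullLattice.exists_isLevel hr.isGraded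
  have hpair (P : HeightOneSpectrum R) : ∃ p q, IsPotentialPair (Fintype.card G) m P p q := by
    obtain ⟨p, hp⟩ := hl.exists_isPotentialPair hf P
    exact ⟨p, hp.of_module (hf.mul_le hm hm fun a ha b hb => ha b hb)⟩
  -- Otherwise a minimal element could be lowered by `n` at `Q` alone. Its products with `M` would
  -- still have weight at least `p (k • b • Q) - q Q` there, hence at least `m` by rounding, so it
  -- would stay in the right order.
  have hlt {P : HeightOneSpectrum R} {p q} (hpq : IsPotentialPair (Fintype.card G) m P p q)
      (b : G) (Q) (hQ : Q ∈ MulAction.orbit G P) : f' b Q < q (b • Q) - q Q + Fintype.card G := by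
    by_contra! hge
    obtain ⟨x, hx0, hx, hxf⟩ := hf'.exists_eq b Q
    obtain ⟨t, ht0, ht, htQ⟩ := exists_ordAt_eq_neg_one (K := K) (b • Q)
    have htx := mul_ne_zero ht0 hx0
    have hxt : C.weight b Q (t * x) = f' b Q - Fintype.card G := by
      rw [C.weight_scale b Q ht0 hx0, ht, hxf]
      ring
    have hmem : C.hom b (t * x) ∈ rightOrder M := by
      refine hom_mem_rightOrder hgr fun k y hy0 hy => ?_
      rw [hom_mul_hom, hm.mem_iff _ _ (C.hom_mul_coeff_ne_zero k b hy0 htx)]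
      intro Q'
      by_cases hQQ : Q' = Q
      · subst hQQ
        refine Int.le_of_modEq_of_lt_add ((hm.modEq _ _).trans (C.weight_modEq _ _ _).symm)
          (hpq.lt (k * b) Q' hQ) ?_
        rw [C.weight_mul k b Q' hy0 htx, hxt, mul_smul]
        have h1 := (hm.mem_iff k y hy0).1 hy (b • Q')
        have h2 := hpq.le k (b • Q') (MulAction.mem_orbit_of_mem_orbit b hQ)
        lia
      · have h1 := hx _ hy
        rw [hom_mul_hom, hm.mem_iff _ _ (C.hom_mul_coeff_ne_zero k b hy0 hx0)] at h1
        have h2 := h1 Q'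
        have h3 := C.weight_le_weight_scale b Q' ht0 hx0
          (htQ _ fun h => hQQ (MulAction.injective b h))
        rw [C.weight_mul k b Q' hy0 hx0] at h2
        rw [C.weight_mul k b Q' hy0 htx]
        lia
    have h1 := (hf'.mem_iff b _ htx).1 hmem Q
    have h2 := card_pos (G := G)
    lia
  refine ⟨hr, fun Γ hΓ hle a ha => ?_⟩
  obtain ⟨γ, hγ⟩ := hΓ.isFullLattice.exists_isLevel hΓ.isGraded
  have hγf := hf'.mono hγ hle
  have hgrΓ : C.IsGraded (Γ.toAddSubgroup : Set A) := hΓ.isGraded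
  refine C.mem_of_hom_coeff_mem (D := (rightOrder M).toAddSubgroup) fun g => ?_
  have hx := hgrΓ.hom_coeff_mem ha g
  by_cases hx0 : C.coeff a g = 0
  · rw [hx0, hom_zero]
    exact AddSubgroup.zero_mem _
  refine hom_mem_rightOrder hgr fun k y hy0 hy => ?_
  rw [hom_mul_hom, hm.mem_iff _ _ (C.hom_mul_coeff_ne_zero k g hy0 hx0)]
  intro Q
  obtain ⟨p, q, hpq⟩ := hpair Q
  have hQ := MulAction.mem_orbit_self (M := G) Q
  -- When `q (b • Q') - q Q'` is in the class of `f' b Q'`, the strict bound `hlt` rounds down to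
  -- `f' b Q' ≤ q (b • Q') - q Q'`, and `γ` is no larger.
  have hγq := hpq.sub_le C.cocycleWeight_modEq hm.modEq hγ.subadditive
    (fun b Q' hQ' hB => (hγf b Q').trans
      (Int.le_of_modEq_of_lt_add ((hf'.modEq b Q').trans hB) (hlt hpq b Q' hQ') le_rfl)) g hQ
  -- The contributions of `q (g • Q)` cancel, so the product has weight at least `p (k • g • Q) - q
  -- Q`; congruence modulo `n` lifts this to `m (k * g) Q`.
  refine Int.le_of_modEq_of_lt_add ((hm.modEq _ _).trans (C.weight_modEq _ _ _).symm)
    (hpq.lt (k * g) Q hQ) ?_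
  rw [C.weight_mul k g Q hy0 hx0, mul_smul]
  have h1 := (hm.mem_iff k y hy0).1 hy (g • Q)
  have h2 := hpq.le k (g • Q) (MulAction.mem_orbit_of_mem_orbit g hQ)
  have h3 := (hγ.mem_iff g _ hx0).1 hx Q
  lia

end CrystallineGraded

/-! ### The opposite ring and the converse implication -/

namespace CrystallineGraded

/-- Coefficients in the opposite ring differ by some `σ_g`; since `σ_g` preserves `R`, common
denominators can be transported. -/
theorem exists_bound_fracAut {R K G : Type*} [CommRing R] [Field K] [Algebra R K]
    [IsFractionRing R K] [Group G] [MulSemiringAction G R] {g : G} {c : K} (hc : c ≠ 0) {p q : K → Prop}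
    (hpq : ∀ x, q x → p (fracAut R K g x))
    (h : ∀ x, p x → ∃ r : R, c * x = algebraMap R K r) :
    ∃ c : K, c ≠ 0 ∧ ∀ x, q x → ∃ r : R, c * x = algebraMap R K r := by
  refine ⟨fracAut R K g⁻¹ c, by simpa using hc, fun x hx => ?_⟩
  obtain ⟨r, hr⟩ := h _ (hpq x hx)
  refine ⟨g⁻¹ • r, ?_⟩
  rw [← fracAut_algebraMap, ← hr, map_mul, ← fracAut_mul, inv_mul_cancel, fracAut_one]

section Opposite

open MulOpposite

variable {R K G A : Type*} [CommRing R] [Field K] [Algebra R K] [IsFractionRing R K]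
  [Group G] [Fintype G] [MulSemiringAction G R] [Ring A] (C : CrystallineGraded R K G A)

theorem u_mul_incl_inv (g : G) (k : K) :
    C.u g⁻¹ * C.incl (fracAut R K g k) = C.incl k * C.u g⁻¹ := by
  rw [C.u_mul_incl, ← fracAut_mul, inv_mul_cancel, fracAut_one]

/-- The opposite ring as a crystalline graded ring with basis `u_{g⁻¹}`. -/
noncomputable def opposite : CrystallineGraded R K G Aᵐᵒᵖ where
  incl := C.incl.op.comp (RingEquiv.toOpposite K).toRingHom
  u g := op (C.u g⁻¹)
  -- The coefficient of `u_{h⁻¹} u_{g⁻¹}` must be moved to the right of `u_{(gh)⁻¹}`, which applies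
  -- `σ_{gh}`.
  α g h := fracAut R K (g * h) (C.α h⁻¹ g⁻¹)
  u_one := by simp [C.u_one]
  existsUnique_coeff a := by
    have key (c : G → K) : (a = ∑ g, op (C.incl (c g)) * op (C.u g⁻¹)) ↔
        C.coeff a.unop = fun g => fracAut R K g (c g⁻¹) := by
      have hsum : ∑ g, op (C.incl (c g)) * op (C.u g⁻¹) =
          op (∑ g, C.hom g (fracAut R K g (c g⁻¹))) := by
        rw [← Equiv.sum_comp (Equiv.inv G), Finset.op_sum]
        refine Finset.sum_congr rfl fun g _ => ?_
        simp only [Equiv.inv_apply, inv_inv, ← op_mul, C.u_mul_incl, hom]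
      rw [hsum, ← unop_inj, unop_op]
      exact ⟨fun h => C.coeff_eq h, fun h => by rw [← C.sum_coeff a.unop, h]⟩
    refine ⟨fun g => fracAut R K g (C.coeff a.unop g⁻¹), (key _).2 ?_, fun c hc => ?_⟩
    · funext g
      change _ = fracAut R K g (fracAut R K g⁻¹ (C.coeff a.unop g⁻¹⁻¹))
      rw [inv_inv, ← fracAut_mul, mul_inv_cancel, fracAut_one]
    · funext g
      simp only [(key c).1 hc]
      rw [inv_inv, ← fracAut_mul, mul_inv_cancel, fracAut_one]
  u_mul_incl g k := by
    change op (C.u g⁻¹) * op (C.incl k) = op (C.incl (fracAut R K g k)) * op (C.u g⁻¹)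
    rw [← op_mul, ← op_mul, u_mul_incl_inv]
  u_mul_u g h := by
    change op (C.u g⁻¹) * op (C.u h⁻¹) =
      op (C.incl (fracAut R K (g * h) (C.α h⁻¹ g⁻¹))) * op (C.u (g * h)⁻¹)
    rw [← op_mul, ← op_mul, u_mul_incl_inv, C.u_mul_u, mul_inv_rev]
  α_ne_zero g h := by simpa using C.α_ne_zero h⁻¹ g⁻¹

theorem opposite_hom (g : G) (x : K) :
    C.opposite.hom g x = op (C.hom g⁻¹ (fracAut R K g⁻¹ x)) := by
  change op (C.incl x) * op (C.u g⁻¹) = _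
  rw [← op_mul, C.u_mul_incl]
  rfl

/-- An additive subgroup of `A`, considered in the opposite ring. -/
def opSubgroup (M : AddSubgroup A) : AddSubgroup Aᵐᵒᵖ :=
  M.comap (opAddEquiv (α := A)).symm.toAddMonoidHom

theorem opposite_hom_coeff (a : Aᵐᵒᵖ) (g : G) :
    C.opposite.hom g (C.opposite.coeff a g) = op (C.hom g⁻¹ (C.coeff a.unop g⁻¹)) := by
  have h : C.opposite.coeff a = fun g => fracAut R K g (C.coeff a.unop g⁻¹) := by
    apply C.opposite.coeff_eq
    simp only [opposite_hom, ← fracAut_mul, inv_mul_cancel, fracAut_one]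
    rw [← Finset.op_sum]
    refine (congrArg op ?_ : op a.unop = _)
    exact (C.sum_coeff a.unop).symm.trans
      (Equiv.sum_comp (Equiv.inv G) fun g => C.hom g (C.coeff a.unop g)).symm
  rw [h, opposite_hom, ← fracAut_mul, inv_mul_cancel, fracAut_one]

theorem opposite_hom_mem {D : AddSubgroup A} {g : G} {x : K} :
    C.opposite.hom g x ∈ opSubgroup D ↔ C.hom g⁻¹ (fracAut R K g⁻¹ x) ∈ D := by
  rw [opposite_hom]; rfl

theorem hom_mem_iff_opposite {D : AddSubgroup A} {g : G} {x : K} :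
    C.hom g x ∈ D ↔ C.opposite.hom g⁻¹ (fracAut R K g⁻¹ x) ∈ opSubgroup D := by
  rw [opposite_hom_mem, inv_inv, ← fracAut_mul, mul_inv_cancel, fracAut_one]

theorem isGraded_opposite {D : AddSubgroup A} :
    C.opposite.IsGraded (opSubgroup D : Set Aᵐᵒᵖ) ↔ C.IsGraded (D : Set A) := by
  constructor
  · intro h
    refine C.isGraded_of_hom_coeff_mem fun a ha g => ?_
    have := h.hom_coeff_mem (show op a ∈ opSubgroup D from ha) g⁻¹
    rw [opposite_hom_coeff, inv_inv] at this
    exact this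
  · intro h
    refine C.opposite.isGraded_of_hom_coeff_mem fun a ha g => ?_
    rw [opposite_hom_coeff]
    exact h.hom_coeff_mem ha g⁻¹

theorem isFullLattice_opposite [IsDedekindDomain R] {D : AddSubgroup A}
    (hgr : C.IsGraded (D : Set A)) :
    C.opposite.IsFullLattice (opSubgroup D) ↔ C.IsFullLattice D := by
  have hgr' := C.isGraded_opposite.2 hgr
  constructor
  · intro h
    refine isFullLattice_of_bounds hgr (fun r m hm => h.mul_right_mem r (op m) hm)
      (fun g => ?_) fun g => ?_
    · obtain ⟨x, hx0, hx⟩ := h.exists_hom_mem hgr' g⁻¹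
      rw [opposite_hom_mem, inv_inv] at hx
      exact ⟨_, by simpa using hx0, hx⟩
    · obtain ⟨c, hc, hb⟩ := h.exists_bound g⁻¹
      exact exists_bound_fracAut hc (fun x hx => C.hom_mem_iff_opposite.1 hx) hb
  · intro h
    refine isFullLattice_of_bounds hgr' (fun r m hm => h.mul_right_mem r m.unop hm)
      (fun g => ?_) fun g => ?_
    · obtain ⟨x, hx0, hx⟩ := h.exists_hom_mem hgr g⁻¹
      rw [hom_mem_iff_opposite, inv_inv] at hx
      exact ⟨_, by simpa using hx0, hx⟩
    · obtain ⟨c, hc, hb⟩ := h.exists_bound g⁻¹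
      exact exists_bound_fracAut hc (fun x hx => C.opposite_hom_mem.1 hx) hb

theorem isGrOrder_opposite [IsDedekindDomain R] {Λ : Subring A} :
    C.opposite.IsGrOrder Λ.op ↔ C.IsGrOrder Λ := by
  have hgr : C.opposite.IsGraded (Λ.op : Set Aᵐᵒᵖ) ↔ C.IsGraded (Λ : Set A) :=
    C.isGraded_opposite (D := Λ.toAddSubgroup)
  exact ⟨fun h => ⟨(C.isFullLattice_opposite (hgr.1 h.isGraded)).1 h.isFullLattice,
      hgr.1 h.isGraded⟩,
    fun h => ⟨(C.isFullLattice_opposite h.isGraded).2 h.isFullLattice, hgr.2 h.isGraded⟩⟩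

theorem isGrMaximalOrder_opposite [IsDedekindDomain R] {Λ : Subring A} :
    C.opposite.IsGrMaximalOrder Λ.op ↔ C.IsGrMaximalOrder Λ := by
  constructor
  · exact fun h => ⟨C.isGrOrder_opposite.1 h.prop, fun Γ hΓ hle =>
      Subring.op_le_op_iff.1 (h.le_of_ge (C.isGrOrder_opposite.2 hΓ) (Subring.op_le_op_iff.2 hle))⟩
  · refine fun h => ⟨C.isGrOrder_opposite.2 h.prop, fun Γ hΓ hle => ?_⟩
    rw [← Subring.op_unop Γ] at hΓ hle ⊢
    exact Subring.op_le_op_iff.2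
      (h.le_of_ge (C.isGrOrder_opposite.1 hΓ) (Subring.op_le_op_iff.1 hle))

theorem leftOrder_opSubgroup (M : AddSubgroup A) :
    leftOrder (opSubgroup M) = (rightOrder M).op := by
  ext a
  exact ⟨fun h m hm => h (op m) hm, fun h m hm => h m.unop hm⟩

theorem rightOrder_opSubgroup (M : AddSubgroup A) :
    rightOrder (opSubgroup M) = (leftOrder M).op := by
  ext a
  exact ⟨fun h m hm => h (op m) hm, fun h m hm => h m.unop hm⟩

end Opposite

end CrystallineGraded

theorem mainTheorem12 {R K G A : Type*} [CommRing R] [IsDedekindDomain R] [Field K]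
    [Algebra R K] [IsFractionRing R K] [Group G] [Fintype G] [MulSemiringAction G R] [Ring A]
    (C : CrystallineGraded R K G A) (M : AddSubgroup A)
    (hM : C.IsFullLattice M) (hgr : C.IsGraded (M : Set A)) :
    C.IsGrMaximalOrder (leftOrder M) ↔ C.IsGrMaximalOrder (rightOrder M) := by
  refine ⟨CrystallineGraded.isGrMaximalOrder_rightOrder hM hgr, fun h => ?_⟩
  rw [← C.isGrMaximalOrder_opposite, ← CrystallineGraded.rightOrder_opSubgroup]
  refine CrystallineGraded.isGrMaximalOrder_rightOrder ((C.isFullLattice_opposite hgr).2 hM)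
    (C.isGraded_opposite.2 hgr) ?_
  rwa [CrystallineGraded.leftOrder_opSubgroup, C.isGrMaximalOrder_opposite]
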